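/- Let $E$ be a (real) Banach lattice and $m$ a positive integer. An $m$-linear form $A\colon E^m\to\mathbb{R}$ is called positive if $A(x_1,\dots,x_m)\ge 0$ whenever $x_1,\dots,x_m\ge 0$, and regular if it is the difference of two positive $m$-linear forms. It is called orthosymmetric if $A(x_1,\dots,x_m)=0$ whenever $|x_i|\wedge|x_j|=0$ for some $i\neq j$. For $x=(x_1,\dots,x_m)\in E^m$ and $1\le k\le m$ put $$J_k^m(x)=\bigvee_{1\le i_1<\dots<i_k\le m}\bigl(x_{i_1}\wedge\dots\wedge x_{i_k}\bigr).$$ **Proposition.** A regular $m$-linear form $A$ on $E^m$ is orthosymmetric if and only if $$A(x_1,\dots,x_m)=A\bigl(J_1^m(x),\dots,J_m^m(x)\bigr)\qquad\text{for every } x=(x_1,\dots,x_m)\in E^m.$$ -/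

import Mathlib

namespace BanachLatticeForm

variable {E : Type*} {m : ℕ}

/-- An `m`-linear form on a vector lattice is positive if it is nonnegative on tuples of
positive elements. -/
def IsPositive [AddCommGroup E] [Lattice E] [Module ℝ E]
    (A : MultilinearMap ℝ (fun _ : Fin m => E) ℝ) : Prop :=
  ∀ x : Fin m → E, (∀ i, 0 ≤ x i) → 0 ≤ A x

/-- An `m`-linear form is regular if it is the difference of two positive `m`-linear forms. -/
def IsRegular [AddCommGroup E] [Lattice E] [Module ℝ E]
    (A : MultilinearMap ℝ (fun _ : Fin m => E) ℝ) : Prop :=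
  ∃ B C : MultilinearMap ℝ (fun _ : Fin m => E) ℝ, IsPositive B ∧ IsPositive C ∧ A = B - C

/-- An `m`-linear form is orthosymmetric if it vanishes on every tuple in which two arguments
in different positions are disjoint. -/
def IsOrthosymmetric [AddCommGroup E] [Lattice E] [Module ℝ E]
    (A : MultilinearMap ℝ (fun _ : Fin m => E) ℝ) : Prop :=
  ∀ x : Fin m → E, (∃ i j : Fin m, i ≠ j ∧ |x i| ⊓ |x j| = 0) → A x = 0

theorem exists_card_eq (k : Fin m) :
    (Finset.univ : Finset {s : Finset (Fin m) // s.card = (k : ℕ) + 1}).Nonempty := by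
  obtain ⟨s, -, hs⟩ := Finset.exists_subset_card_eq
    (s := (Finset.univ : Finset (Fin m))) (n := (k : ℕ) + 1) (by simp)
  exact ⟨⟨s, hs⟩, Finset.mem_univ _⟩

theorem nonempty_of_card_eq {k : ℕ} {s : Finset (Fin m)} (h : s.card = k + 1) : s.Nonempty :=
  Finset.card_pos.mp (by omega)

/-- `J x k` is the supremum, over all sets `s` of exactly `k + 1` indices, of the infimum of the
`x i` with `i ∈ s`. Positions in `Fin m` start at `0`, so `J x k` is the entry usually written
with the subscript `k + 1`. -/
def J [Lattice E] (x : Fin m → E) (k : Fin m) : E :=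
  (Finset.univ : Finset {s : Finset (Fin m) // s.card = (k : ℕ) + 1}).sup' (exists_card_eq k)
    (fun s => s.1.inf' (nonempty_of_card_eq s.2) x)

end BanachLatticeForm

/-! Sorting by compare-exchange moves, `(x i, x j) ↦ (x i ⊔ x j, x i ⊓ x j)`, ends at an antitone
tuple, which `J` fixes. Each move preserves `J` because the lattice is distributive, and preserves
`A` when `A` is regular and orthosymmetric; hence `A x = A (J x)`. For `A`, fix the other arguments.
The parts of `x` and `y` above `x ⊓ y` are disjoint, so expanding the vanishing form on them gives
the claim once the bilinear form is symmetric. Symmetry is the analytic core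
(`eq_zero_of_alternating`). Conversely, the last entry of `J x` is the infimum of all entries, which
is zero for a positive tuple with a disjoint pair; signs are handled by multilinearity. -/

namespace BanachLatticeForm

/-! ### Sorting in a lattice -/

section CompareExchange

variable {E : Type*} {m : ℕ}

/-- Replaces the entries at `i` and `j` by their supremum and their infimum. -/
def compareExchange [Lattice E] (i j : Fin m) (x : Fin m → E) : Fin m → E :=
  Function.update (Function.update x i (x i ⊔ x j)) j (x i ⊓ x j)

section Apply

variable [Lattice E] {i j l : Fin m} (x : Fin m → E)

theorem compareExchange_right : compareExchange i j x j = x i ⊓ x j := by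
  simp [compareExchange]

theorem compareExchange_left (h : i ≠ j) : compareExchange i j x i = x i ⊔ x j := by
  simp [compareExchange, h]

theorem compareExchange_of_ne (hi : l ≠ i) (hj : l ≠ j) : compareExchange i j x l = x l := by
  simp [compareExchange, hi, hj]

theorem inf'_le_J {k : Fin m} {s : Finset (Fin m)} (hs : s.card = (k : ℕ) + 1) :
    s.inf' (nonempty_of_card_eq hs) x ≤ J x k :=
  Finset.le_sup' (fun s : {s : Finset (Fin m) // s.card = (k : ℕ) + 1} =>
    s.1.inf' (nonempty_of_card_eq s.2) x) (Finset.mem_univ ⟨s, hs⟩)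

theorem le_J {k : Fin m} {s : Finset (Fin m)} (hs : s.card = (k : ℕ) + 1) {z : E}
    (hz : ∀ l ∈ s, z ≤ x l) : z ≤ J x k :=
  (Finset.le_inf' _ _ hz).trans (inf'_le_J x hs)

theorem J_le {k : Fin m} {z : E}
    (hz : ∀ (s : Finset (Fin m)) (hs : s.card = (k : ℕ) + 1),
      s.inf' (nonempty_of_card_eq hs) x ≤ z) : J x k ≤ z :=
  Finset.sup'_le _ _ fun s _ => hz s.1 s.2

theorem J_of_antitone {x : Fin m → E} (hx : Antitone x) : J x = x := by
  funext k
  apply le_antisymm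
  · refine J_le x fun s hs => ?_
    obtain ⟨l, hl, hkl⟩ : ∃ l ∈ s, k ≤ l := by
      by_contra! h
      have : s ⊆ Finset.Iio k := fun l hl => Finset.mem_Iio.2 (h l hl)
      have := Finset.card_le_card this
      rw [Fin.card_Iio] at this
      omega
    exact (Finset.inf'_le _ hl).trans (hx hkl)
  · exact le_J x (s := Finset.Iic k) (Fin.card_Iic k) fun l hl => hx (Finset.mem_Iic.1 hl)

end Apply

theorem card_insert_erase {s : Finset (Fin m)} {i j : Fin m} (hi : i ∈ s) (hj : j ∉ s) :
    (insert j (s.erase i)).card = s.card := by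
  rw [Finset.card_insert_of_notMem (by simp [hj]), Finset.card_erase_of_mem hi]
  have := Finset.card_pos.2 ⟨i, hi⟩
  omega

theorem J_compareExchange [DistribLattice E] {i j : Fin m} (h : i ≠ j) (x : Fin m → E) :
    J (compareExchange i j x) = J x := by
  have hl := compareExchange_left x h
  have hr := compareExchange_right (i := i) (j := j) x
  have hn := fun l => compareExchange_of_ne (i := i) (j := j) (l := l) x
  set y := compareExchange i j x
  funext k
  apply le_antisymm <;> refine J_le _ fun s hs => ?_
  · have hz : ∀ l ∈ s, s.inf' (nonempty_of_card_eq hs) y ≤ y l := fun l => Finset.inf'_le _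
    set z := s.inf' (nonempty_of_card_eq hs) y
    by_cases hj : j ∈ s
    · have := hz j hj
      rw [hr] at this
      refine le_J x hs fun l hls => ?_
      by_cases hli : l = i
      · exact hli ▸ this.trans inf_le_left
      by_cases hlj : l = j
      · exact hlj ▸ this.trans inf_le_right
      · rw [← hn l hli hlj]
        exact hz l hls
    by_cases hi : i ∈ s
    -- Distributivity splits `z ≤ x i ⊔ x j`; one piece is bounded using `s`, the other using `s`
    -- with `i` traded for `j`.
    · have hzi : z = z ⊓ x i ⊔ z ⊓ x j := by
        rw [← inf_sup_left, eq_comm, inf_eq_left, ← hl]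
        exact hz i hi
      rw [hzi]
      refine sup_le (le_J x hs fun l hls => ?_)
        (le_J x (s := insert j (s.erase i)) ((card_insert_erase hi hj).trans hs) fun l hls => ?_)
      · by_cases hli : l = i
        · exact hli ▸ inf_le_right
        · have := hz l hls
          rw [hn l hli (ne_of_mem_of_not_mem hls hj)] at this
          exact inf_le_left.trans this
      · by_cases hlj : l = j
        · exact hlj ▸ inf_le_right
        · have hls : l ≠ i ∧ l ∈ s := by simpa [hlj] using hls
          have := hz l hls.2
          rw [hn l hls.1 hlj] at this
          exact inf_le_left.trans this
    · refine le_J x hs fun l hls => ?_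
      rw [← hn l (ne_of_mem_of_not_mem hls hi) (ne_of_mem_of_not_mem hls hj)]
      exact hz l hls
  · have hz : ∀ l ∈ s, s.inf' (nonempty_of_card_eq hs) x ≤ x l := fun l => Finset.inf'_le _
    set z := s.inf' (nonempty_of_card_eq hs) x
    by_cases hj : j ∈ s
    · by_cases hi : i ∈ s
      · refine le_J y hs fun l hls => ?_
        by_cases hli : l = i
        · rw [hli, hl]
          exact le_sup_of_le_left (hz i hi)
        by_cases hlj : l = j
        · rw [hlj, hr]
          exact le_inf (hz i hi) (hz j hj)
        · rw [hn l hli hlj]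
          exact hz l hls
      · refine le_J y (s := insert i (s.erase j)) ((card_insert_erase hj hi).trans hs)
          fun l hls => ?_
        by_cases hli : l = i
        · rw [hli, hl]
          exact le_sup_of_le_right (hz j hj)
        · have hls : l ≠ j ∧ l ∈ s := by simpa [hli] using hls
          rw [hn l hli hls.1]
          exact hz l hls.2
    · refine le_J y hs fun l hls => ?_
      by_cases hli : l = i
      · rw [hli, hl]
        exact le_sup_of_le_left (hz i (hli ▸ hls))
      · rw [hn l hli (ne_of_mem_of_not_mem hls hj)]
        exact hz l hls

/-- A property preserved by `compareExchange i j` for `i < j` passes from a tuple to some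
antitone tuple. -/
theorem exists_antitone_of_compareExchange [Lattice E] {P : (Fin m → E) → Prop}
    (hP : ∀ i j : Fin m, i < j → ∀ x, P x → P (compareExchange i j x))
    {x : Fin m → E} (hx : P x) : ∃ y, P y ∧ Antitone y := by
  -- Selection sort: after `k` rounds the first `k` entries dominate everything to their right.
  have outer : ∀ k : ℕ, ∃ y, P y ∧ ∀ i j : Fin m, (i : ℕ) < k → i < j → y j ≤ y i := by
    intro k
    induction k with
    | zero => exact ⟨x, hx, by simp⟩
    | succ k ih =>
      by_cases hk : k < m
      · have inner : ∀ l : ℕ, ∃ y, P y ∧ (∀ i j : Fin m, (i : ℕ) < k → i < j → y j ≤ y i) ∧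
            ∀ j : Fin m, k < (j : ℕ) → (j : ℕ) < l → y j ≤ y ⟨k, hk⟩ := by
          intro l
          induction l with
          | zero => obtain ⟨y, hy, h⟩ := ih; exact ⟨y, hy, h, by simp⟩
          | succ l ihl =>
            obtain ⟨y, hy, h1, h2⟩ := ihl
            by_cases hkl : k < l ∧ l < m
            · obtain ⟨a, ha⟩ : ∃ a : Fin m, a = ⟨k, hk⟩ := ⟨_, rfl⟩
              obtain ⟨b, hb⟩ : ∃ b : Fin m, b = ⟨l, hkl.2⟩ := ⟨_, rfl⟩
              have hak : (a : ℕ) = k := by simp [ha]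
              have hbl : (b : ℕ) = l := by simp [hb]
              have hab : a < b := Fin.lt_def.2 (by omega)
              rw [← ha] at h2 ⊢
              refine ⟨compareExchange a b y, hP a b hab y hy, fun i j hi hij => ?_,
                fun j hj hjl => ?_⟩
              · have hia : i < a := Fin.lt_def.2 (by omega)
                rw [compareExchange_of_ne (l := i) y hia.ne (hia.trans hab).ne]
                by_cases hjb : j = b
                · rw [hjb, compareExchange_right]
                  exact inf_le_of_left_le (h1 i a hi hia)
                by_cases hja : j = a
                · rw [hja, compareExchange_left y hab.ne]
                  exact sup_le (h1 i a hi hia) (h1 i b hi (hia.trans hab))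
                · rw [compareExchange_of_ne y hja hjb]
                  exact h1 i j hi hij
              · rw [compareExchange_left y hab.ne]
                by_cases hjb : j = b
                · rw [hjb, compareExchange_right]
                  exact inf_le_left.trans le_sup_left
                · have hjb' : (j : ℕ) ≠ b := fun h => hjb (Fin.ext h)
                  have hja : j ≠ a := fun h => by rw [h] at hj; omega
                  rw [compareExchange_of_ne y hja hjb]
                  exact le_sup_of_le_left (h2 j hj (by omega))
            · exact ⟨y, hy, h1, fun j hj hjl => h2 j hj (by omega)⟩
        obtain ⟨y, hy, h1, h2⟩ := inner m
        refine ⟨y, hy, fun i j hi hij => ?_⟩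
        rcases Nat.lt_succ_iff_lt_or_eq.1 hi with hi | hi
        · exact h1 i j hi hij
        · have : i = ⟨k, hk⟩ := Fin.ext hi
          rw [this] at hij ⊢
          exact h2 j hij j.2
      · obtain ⟨y, hy, h⟩ := ih
        exact ⟨y, hy, fun i j hi hij => h i j (by omega) hij⟩
  obtain ⟨y, hy, h⟩ := outer m
  refine ⟨y, hy, fun i j hij => ?_⟩
  rcases hij.eq_or_lt with rfl | hij
  · exact le_rfl
  · exact h i j i.2 hij

end CompareExchange

/-! ### Symmetry of disjointness-annihilating bilinear forms -/

section Bilinear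

theorem inf_eq_zero_of_le {E : Type*} [AddCommGroup E] [Lattice E] {a b c d : E} (hc : 0 ≤ c) (hd : 0 ≤ d) (hca : c ≤ a) (hdb : d ≤ b)
    (h : a ⊓ b = 0) : c ⊓ d = 0 :=
  le_antisymm (h ▸ inf_le_inf hca hdb) (le_inf hc hd)

variable {E : Type*} [AddCommGroup E] [Lattice E] [IsOrderedAddMonoid E]

theorem posPart_sub_posPart_sub {u : E} (hu : 0 ≤ u) (y : E) : y⁺ - (y - u)⁺ = y⁺ ⊓ u := by
  have : (y⁺ - u)⁺ = (y - u)⁺ := by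
    rw [posPart_def, posPart_def, posPart_def, sup_sub, sup_assoc, zero_sub,
      sup_eq_right.2 (neg_nonpos.2 hu)]
  rw [inf_eq_sub_posPart_sub, this]

theorem sub_posPart_inf_inf_posPart_sub (u y : E) :
    (u - y⁺ ⊓ u) ⊓ (y - u)⁺ = 0 := by
  apply le_antisymm
  · rw [← posPart_inf_negPart_eq_zero (y - u), inf_comm]
    refine inf_le_inf_left _ ?_
    rw [sub_inf, sub_self, negPart_def, neg_sub]
    exact sup_le_sup_right (sub_le_sub_left (le_posPart y) u) 0
  · exact le_inf (sub_nonneg.2 inf_le_right) (posPart_nonneg _)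

variable [Module ℝ E]

/-- Cut `n • g` into layers `G 1, …, G n` of height at most `u`. Disjointness and alternation turn
each `a u (G (k + 1))` into a value on increments, whose bounds telescope to `D u u` independently
of `n`. Only `ℝ` need be Archimedean. -/
theorem eq_zero_of_alternating {a D : E →ₗ[ℝ] E →ₗ[ℝ] ℝ} (halt : ∀ x, a x x = 0)
    (hdisj : ∀ x y, 0 ≤ x → 0 ≤ y → x ⊓ y = 0 → a x y = 0)
    (hD : ∀ x y, 0 ≤ x → 0 ≤ y → |a x y| ≤ D x y) {u g : E} (hg : 0 ≤ g) (hgu : g ≤ u) :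
    a u g = 0 := by
  have hu : 0 ≤ u := hg.trans hgu
  have hD0 : ∀ x y, 0 ≤ x → 0 ≤ y → 0 ≤ D x y :=
    fun x y hx hy => (abs_nonneg _).trans (hD x y hx hy)
  have key : ∀ n : ℕ, n * |a u g| ≤ D u u := by
    intro n
    let Y : ℕ → E := fun k => n • g + u - k • u
    let G : ℕ → E := fun k => (Y k)⁺ ⊓ u
    have hY (k : ℕ) : Y (k + 1) = Y k - u := by
      simp only [Y, succ_nsmul]; abel
    have hG (k : ℕ) : G k = (Y k)⁺ - (Y (k + 1))⁺ := by
      rw [hY, posPart_sub_posPart_sub hu]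
    have hG0 (k : ℕ) : 0 ≤ G k := le_inf (posPart_nonneg _) hu
    have hGu (k : ℕ) : G k ≤ u := inf_le_right
    have hGanti (k : ℕ) : G (k + 1) ≤ G k := by
      refine inf_le_inf_right _ (posPart_mono ?_)
      rw [hY]
      exact sub_le_self _ hu
    have hGdisj (k : ℕ) : (u - G k) ⊓ G (k + 1) = 0 := by
      refine inf_eq_zero_of_le (sub_nonneg.2 (hGu k)) (hG0 _) le_rfl ?_
        (sub_posPart_inf_inf_posPart_sub u (Y k))
      rw [← hY]
      exact inf_le_left
    have hGzero : G 0 = u := by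
      refine inf_eq_right.2 (le_trans ?_ (le_posPart _))
      simpa [Y] using nsmul_nonneg hg n
    have hsum : ∑ k ∈ Finset.range n, G (k + 1) = n • g := by
      simp_rw [hG]
      rw [Finset.sum_range_sub' (fun k => (Y (k + 1))⁺) n]
      have h1 : Y (0 + 1) = n • g := by simp [Y]
      have h2 : (Y (n + 1))⁺ = 0 := by
        rw [posPart_eq_zero]
        have : Y (n + 1) = n • g - n • u := by simp only [Y, succ_nsmul]; abel
        rw [this, sub_nonpos]
        exact nsmul_le_nsmul_right hgu n
      rw [h1, h2, sub_zero, posPart_eq_self.2 (nsmul_nonneg hg n)]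
    have hstep (k : ℕ) : a u (G (k + 1)) = a (G k - G (k + 1)) (G (k + 1) - G (k + 2)) := by
      have h1 := hdisj _ _ (sub_nonneg.2 (hGu k)) (hG0 _) (hGdisj k)
      have h2 : a (G k - G (k + 1)) (G (k + 2)) = 0 :=
        hdisj _ _ (sub_nonneg.2 (hGanti k)) (hG0 _)
          (inf_eq_zero_of_le (sub_nonneg.2 (hGanti k)) (hG0 _)
            (sub_le_sub_right (hGu k) _) le_rfl (hGdisj (k + 1)))
      have h3 := halt (G (k + 1))
      simp only [map_sub, LinearMap.sub_apply] at h1 h2 ⊢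
      linarith
    have hbound (k : ℕ) : |a u (G (k + 1))| ≤ D (G k) u - D (G (k + 1)) u := by
      have h0 := sub_nonneg.2 (hGanti k)
      have h1 := sub_nonneg.2 (hGanti (k + 1))
      have h2 : G (k + 1) - G (k + 2) ≤ u := (sub_le_self _ (hG0 _)).trans (hGu _)
      have h3 := hD0 _ _ h0 (sub_nonneg.2 h2)
      rw [hstep]
      refine (hD _ _ h0 h1).trans ?_
      rw [map_sub (D _) u] at h3
      have h4 : D (G k - G (k + 1)) u = D (G k) u - D (G (k + 1)) u := by simp
      linarith
    calc n * |a u g| = |a u (n • g)| := by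
          rw [map_nsmul, nsmul_eq_mul, abs_mul, Nat.abs_cast]
      _ = |∑ k ∈ Finset.range n, a u (G (k + 1))| := by rw [← hsum, map_sum]
      _ ≤ ∑ k ∈ Finset.range n, |a u (G (k + 1))| := Finset.abs_sum_le_sum_abs _ _
      _ ≤ ∑ k ∈ Finset.range n, (D (G k) u - D (G (k + 1)) u) :=
          Finset.sum_le_sum fun k _ => hbound k
      _ = D u u - D (G n) u := by rw [Finset.sum_range_sub' (fun k => D (G k) u) n, hGzero]
      _ ≤ D u u := sub_le_self _ (hD0 _ _ (hG0 n) hu)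
  by_contra h
  obtain ⟨n, hn⟩ := exists_nat_gt (D u u / |a u g|)
  rw [div_lt_iff₀ (abs_pos.2 h)] at hn
  exact absurd (key n) (not_le.2 hn)

theorem apply_comm_of_disjoint {a D : E →ₗ[ℝ] E →ₗ[ℝ] ℝ}
    (hdisj : ∀ x y, 0 ≤ x → 0 ≤ y → x ⊓ y = 0 → a x y = 0)
    (hD : ∀ x y, 0 ≤ x → 0 ≤ y → |a x y| ≤ D x y) (x y : E) : a x y = a y x := by
  have pos : ∀ x y, 0 ≤ x → 0 ≤ y → a x y = a y x := by
    intro x y hx hy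
    have := eq_zero_of_alternating (a := a - a.flip) (D := D + D.flip) (by simp)
      (fun x y hx hy h => by
        simp [hdisj x y hx hy h, hdisj y x hy hx (inf_comm x y ▸ h)])
      (fun x y hx hy => by
        simpa using (abs_sub _ _).trans (add_le_add (hD x y hx hy) (hD y x hy hx)))
      -- Taking `u = x + y` and `g = y`, the `y, y` terms cancel.
      hy (le_add_of_nonneg_left hx)
    simp only [LinearMap.sub_apply, LinearMap.flip_apply, map_add, LinearMap.add_apply] at this
    linarith
  have h1 := pos _ _ (posPart_nonneg x) (posPart_nonneg y)
  have h2 := pos _ _ (posPart_nonneg x) (negPart_nonneg y)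
  have h3 := pos _ _ (negPart_nonneg x) (posPart_nonneg y)
  have h4 := pos _ _ (negPart_nonneg x) (negPart_nonneg y)
  rw [← posPart_sub_negPart x, ← posPart_sub_negPart y]
  simp only [map_sub, LinearMap.sub_apply]
  linarith

theorem apply_sup_inf {a D : E →ₗ[ℝ] E →ₗ[ℝ] ℝ}
    (hdisj : ∀ x y, 0 ≤ x → 0 ≤ y → x ⊓ y = 0 → a x y = 0)
    (hD : ∀ x y, 0 ≤ x → 0 ≤ y → |a x y| ≤ D x y) (x y : E) :
    a (x ⊔ y) (x ⊓ y) = a x y := by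
  have h : a (x - x ⊓ y) (y - x ⊓ y) = 0 :=
    hdisj _ _ (sub_nonneg.2 inf_le_left) (sub_nonneg.2 inf_le_right)
      (by rw [← inf_sub, sub_self])
  have hsup : x ⊔ y = x + y - x ⊓ y := by rw [← inf_add_sup x y]; abel
  have hc := apply_comm_of_disjoint hdisj hD y (x ⊓ y)
  rw [hsup]
  simp only [map_sub, map_add, LinearMap.sub_apply, LinearMap.add_apply] at h ⊢
  linarith

end Bilinear

/-! ### Reduction of multilinear forms to two arguments -/

section Multilinear

variable {E : Type*} {m : ℕ} [AddCommGroup E] [Module ℝ E]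

/-- The bilinear form obtained by fixing all arguments except those at `i` and `j`. -/
def bilinear (A : MultilinearMap ℝ (fun _ : Fin m => E) ℝ) (w : Fin m → E) {i j : Fin m}
    (h : i ≠ j) : E →ₗ[ℝ] E →ₗ[ℝ] ℝ :=
  LinearMap.mk₂ ℝ (fun x y => A (Function.update (Function.update w i x) j y))
    (fun x x' y => by simp only [Function.update_comm h, A.map_update_add])
    (fun c x y => by simp only [Function.update_comm h, A.map_update_smul])
    (fun x y y' => by simp only [A.map_update_add])
    (fun c x y => by simp only [A.map_update_smul])

@[simp]
theorem bilinear_apply (A : MultilinearMap ℝ (fun _ : Fin m => E) ℝ) (w : Fin m → E)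
    {i j : Fin m} (h : i ≠ j) (x y : E) :
    bilinear A w h x y = A (Function.update (Function.update w i x) j y) := rfl

variable [Lattice E] [IsOrderedAddMonoid E]

theorem apply_eq_sum_posPart_negPart (A : MultilinearMap ℝ (fun _ : Fin m => E) ℝ)
    (x : Fin m → E) :
    ∃ c : Finset (Fin m) → ℝ, (∀ s, |c s| = 1) ∧
      A x = ∑ s : Finset (Fin m), c s * A (s.piecewise (fun i => (x i)⁺) (fun i => (x i)⁻)) := by
  refine ⟨fun s => ∏ i, if i ∈ s then 1 else -1, fun s => ?_, ?_⟩
  · rw [Finset.abs_prod]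
    exact Finset.prod_eq_one fun i _ => by split_ifs <;> simp
  · have hx : x = (fun i => (x i)⁺) + (fun i => -(x i)⁻) :=
      funext fun i => (by simp [← sub_eq_add_neg])
    conv_lhs => rw [hx, A.map_add_univ]
    refine Finset.sum_congr rfl fun s _ => ?_
    rw [← smul_eq_mul, ← A.map_smul_univ]
    congr 1
    funext i
    by_cases hi : i ∈ s <;> simp [hi]

/-- Expanding into positive and negative parts gives the same nonnegative terms on both sides, up to
sign on the left. -/
theorem IsPositive.abs_apply_le {B : MultilinearMap ℝ (fun _ : Fin m => E) ℝ}
    (hB : IsPositive B) (x : Fin m → E) : |B x| ≤ B (fun i => |x i|) := by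
  obtain ⟨c, hc, h⟩ := apply_eq_sum_posPart_negPart B x
  have habs : (fun i => |x i|) = (fun i => (x i)⁺) + (fun i => (x i)⁻) :=
    funext fun i => (posPart_add_negPart (x i)).symm
  rw [h, habs, B.map_add_univ]
  refine (Finset.abs_sum_le_sum_abs _ _).trans (Finset.sum_le_sum fun s _ => ?_)
  rw [abs_mul, hc, one_mul, abs_of_nonneg]
  refine hB _ fun i => ?_
  by_cases hi : i ∈ s
  · simp [hi]
  · simp [hi]

variable {A : MultilinearMap ℝ (fun _ : Fin m => E) ℝ}

theorem IsOrthosymmetric.apply_compareExchange (hA : IsRegular A) (ho : IsOrthosymmetric A)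
    {i j : Fin m} (h : i ≠ j) (x : Fin m → E) : A (compareExchange i j x) = A x := by
  obtain ⟨B, C, hB, hC, hABC⟩ := hA
  have key := apply_sup_inf (a := bilinear A x h)
    (D := bilinear (B + C) (fun l => |x l|) h)
    (fun y z hy hz hyz => ho _ ⟨i, j, h, by
      simpa [h, abs_of_nonneg hy, abs_of_nonneg hz] using hyz⟩)
    (fun y z hy hz => by
      have habs : (fun l => |Function.update (Function.update x i y) j z l|) =
          Function.update (Function.update (fun l => |x l|) i y) j z := by
        funext l
        by_cases hlj : l = j
        · subst hlj; simp [abs_of_nonneg hz]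
        by_cases hli : l = i
        · subst hli; simp [hlj, abs_of_nonneg hy]
        · simp [hlj, hli]
      have hB' := hB.abs_apply_le (Function.update (Function.update x i y) j z)
      have hC' := hC.abs_apply_le (Function.update (Function.update x i y) j z)
      rw [habs] at hB' hC'
      simp only [bilinear_apply, hABC, sub_apply, add_apply]
      exact (abs_sub _ _).trans (add_le_add hB' hC'))
    (x i) (x j)
  simpa [compareExchange] using key

theorem IsOrthosymmetric.apply_J (hA : IsRegular A) (ho : IsOrthosymmetric A) (x : Fin m → E) :
    A x = A (J x) := by
  obtain ⟨y, ⟨hAy, hJy⟩, hy⟩ := exists_antitone_of_compareExchange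
    (P := fun y => A y = A x ∧ J y = J x)
    (fun i j hij y ⟨h1, h2⟩ => ⟨(ho.apply_compareExchange hA hij.ne y).trans h1,
      (@J_compareExchange E m (AddCommGroup.toDistribLattice E) i j hij.ne y).trans h2⟩)
    ⟨rfl, rfl⟩
  rw [← hJy, J_of_antitone hy, hAy]

theorem isOrthosymmetric_of_apply_J (hJ : ∀ x, A x = A (J x)) : IsOrthosymmetric A := by
  have pos : ∀ x : Fin m → E, (∀ i, 0 ≤ x i) → ∀ i j, i ≠ j → x i ⊓ x j = 0 → A x = 0 := by
    intro x hx i j hij hd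
    have hm : 0 < m := i.pos
    rw [hJ]
    -- Only the full index set has `m` elements, so this entry is the infimum of all `x l`.
    refine A.map_coord_zero (⟨m - 1, by omega⟩ : Fin m) (le_antisymm ?_ ?_)
    · refine J_le x fun s hs => ?_
      have hs' : s = Finset.univ := by
        rw [← Finset.card_eq_iff_eq_univ, hs, Fintype.card_fin]
        simp only
        omega
      rw [← hd]
      subst hs'
      exact le_inf (Finset.inf'_le _ (Finset.mem_univ i)) (Finset.inf'_le _ (Finset.mem_univ j))
    · exact le_J x (s := Finset.univ) (by simp only [Finset.card_univ, Fintype.card_fin]; omega)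
        fun l _ => hx l
  rintro x ⟨i, j, hij, hd⟩
  obtain ⟨c, -, h⟩ := apply_eq_sum_posPart_negPart A x
  rw [h]
  refine Finset.sum_eq_zero fun s _ => ?_
  have hnonneg (l : Fin m) : 0 ≤ s.piecewise (fun i => (x i)⁺) (fun i => (x i)⁻) l := by
    by_cases hl : l ∈ s
    · simp [hl]
    · simp [hl]
  have hle (l : Fin m) : s.piecewise (fun i => (x i)⁺) (fun i => (x i)⁻) l ≤ |x l| := by
    rw [← posPart_add_negPart (x l)]
    by_cases hl : l ∈ s
    · simp [hl]
    · simp [hl]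
  rw [pos _ hnonneg i j hij
    (inf_eq_zero_of_le (hnonneg i) (hnonneg j) (hle i) (hle j) hd), mul_zero]

end Multilinear

end BanachLatticeForm

theorem mainTheorem6 {E : Type*} [NormedAddCommGroup E] [Lattice E] [IsOrderedAddMonoid E]
    [NormedSpace ℝ E] [IsOrderedModule ℝ E] [HasSolidNorm E] [CompleteSpace E]
    (m : ℕ) (A : MultilinearMap ℝ (fun _ : Fin m => E) ℝ)
    (hA : BanachLatticeForm.IsRegular A) :
    BanachLatticeForm.IsOrthosymmetric A ↔
      ∀ x : Fin m → E, A x = A (BanachLatticeForm.J x) :=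
  ⟨fun ho => ho.apply_J hA, BanachLatticeForm.isOrthosymmetric_of_apply_J⟩
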